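/- Let $G$ be a (finite-dimensional, real, smooth) Lie group with unit $e$, let $l_g(h)=gh$ be the left shifts, write $dl_g$ for $(dl_g)_e:T_eG\to T_gG$, and let $\mathfrak g=T_eG$ carry the Lie bracket of left-invariant vector fields ($[u,v]=\operatorname{ad}(u)(v)$). Consider the Hamiltonian of the left-invariant time-optimal problem $$H(g,p,u)=p\big(dl_g(u)\big),\qquad g\in G,\quad p\in T_g^*G,\quad u\in\mathfrak g .$$ Identify a covector $p\in T_g^*G$ with the covector $\psi\in\mathfrak g^*=T_e^*G$ given by $\psi(v)=p(dl_g(v))$, $v\in\mathfrak g$, so that $H(g,p,u)=\psi(u)$. Then the Hamiltonian system $$\dot g=\frac{\partial H}{\partial p},\qquad \dot p=-\frac{\partial H}{\partial g}\qquad (u \text{ held fixed in the partial derivatives})$$ has the form $$\dot g=dl_g(u),\qquad \psi(v)'=\psi([u,v])\quad\text{for all } v\in\mathfrak g .$$ Precisely: let $J\subset\mathbb R$ be an interval with more than one point, $u:J\to\mathfrak g$ any function (the control), $g:J\to G$ a continuous curve, $p(s)\in T^*_{g(s)}G$ for $s\in J$, and let $\psi(s)\in\mathfrak g^*$ correspond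 to $p(s)$. Let $t\in J$, and let $\varphi$ be any chart of the smooth structure of $G$ with $g(t)$ in its domain. Let $(x,\xi)$ be the canonical coordinates on the cotangent bundle induced by $\varphi$ ($x=\varphi(g)$, and $\xi$ is the pull-back of $p$ by $\varphi^{-1}$), and write $H=H(x,\xi,u)$ in these coordinates. Then the canonical equations $$x'(t)=\frac{\partial H}{\partial \xi}\big(x(t),\xi(t),u(t)\big),\qquad \xi'(t)=-\frac{\partial H}{\partial x}\big(x(t),\xi(t),u(t)\big)$$ hold if and only if $$\dot g(t)=dl_{g(t)}(u(t))\qquad\text{and}\qquad (\psi(v))'(t)=\psi(t)([u(t),v])\ \text{ for all } v\in\mathfrak g .$$ Here each equation includes the existence of the derivative on its left-hand side, and derivatives at end points of $J$ are one-sided. -/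

import Mathlib

open scoped Manifold ContDiff Topology

noncomputable section

namespace LieHamiltonian

variable {E : Type*} [NormedAddCommGroup E] [NormedSpace ℝ E]
  {H : Type*} [TopologicalSpace H] (I : ModelWithCorners ℝ E H)
  {G : Type*} [TopologicalSpace G] [ChartedSpace H G]

/-- The cotangent space `T*_g G`. -/
abbrev CotangentSpace (g : G) : Type _ := TangentSpace I g →L[ℝ] ℝ

/-- The momentum coordinates of a covector `p ∈ T*_g G` in the canonical (cotangent) coordinates
`(x, ξ)` induced by the chart `φ` of `G` around `g`: the position is `x = φ g`, and `ξ ∈ E*` is the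
pull-back of `p` under the local parametrization `φ⁻¹`, so that `ξ e = p (∂_e)` for the coordinate
vector `∂_e = d(φ⁻¹)_x e`. -/
def momentumCoord (φ : OpenPartialHomeomorph G H) (g : G) (p : CotangentSpace I g) : E →L[ℝ] ℝ :=
  (show E →L[ℝ] ℝ from p).comp
    (show E →L[ℝ] E from mfderiv 𝓘(ℝ, E) I (φ.extend I).symm (φ.extend I g))

/-- The covector with canonical coordinates `(x, ξ)` in the chart `φ`; it sits at the
point `φ⁻¹ x`. -/
def covectorOfCoord (φ : OpenPartialHomeomorph G H) (x : E) (ξ : E →L[ℝ] ℝ) :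
    CotangentSpace I ((φ.extend I).symm x) :=
  ξ.comp (show E →L[ℝ] E from mfderiv I 𝓘(ℝ, E) (φ.extend I) ((φ.extend I).symm x))

variable [Group G]

/-- `(dl_g)_e : 𝔤 = T_e G → T_g G`, the differential at the unit of the left shift
`l_g : h ↦ g * h`. -/
def dl (g : G) : GroupLieAlgebra I G →L[ℝ] TangentSpace I g :=
  show E →L[ℝ] E from mfderiv I I (fun h : G => g * h) (1 : G)

/-- The Hamiltonian of the time-optimal problem, `H(g, p, u) = p (dl_g u)`, for `p ∈ T*_g G` and
`u ∈ 𝔤`. -/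
def hamiltonian (g : G) (p : CotangentSpace I g) (u : GroupLieAlgebra I G) : ℝ :=
  p (dl I g u)

/-- The identification of a covector `p ∈ T*_g G` with the covector `ψ ∈ 𝔤* = T*_e G` that is the
value at `e` of the left-invariant 1-form extending `p`: `ψ v = p (dl_g v)`. -/
def leftTrivialize (g : G) (p : CotangentSpace I g) : CotangentSpace I (1 : G) :=
  p.comp (dl I g)

/-- `H(g, ψ, u) = ψ(u)` after the identification. -/
theorem hamiltonian_eq (g : G) (p : CotangentSpace I g) (u : GroupLieAlgebra I G) :
    hamiltonian I g p u = leftTrivialize I g p u := rfl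

/-- The Hamiltonian `H(·, ·, u)` written in the canonical coordinates `(x, ξ)` of the chart `φ`. -/
def coordHamiltonian (φ : OpenPartialHomeomorph G H) (u : GroupLieAlgebra I G)
    (x : E) (ξ : E →L[ℝ] ℝ) : ℝ :=
  hamiltonian I ((φ.extend I).symm x) (covectorOfCoord I φ x ξ) u

/-- Hamilton's canonical equations `x' = ∂H/∂ξ`, `ξ' = -∂H/∂x` at the time `t`, in the canonical
coordinates `(x, ξ)` of the chart `φ`, for a curve `s ↦ (g s, p s)` with `p s ∈ T*_{g s} G`,
defined for `s ∈ J`; the partial derivatives of `H(·, ·, u)` are taken with the control value `u`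
held fixed. Time derivatives are relative to `J`, i.e. one-sided at the end points. Since
`∂H/∂ξ` is a linear functional on `E*`, the first equation is tested on every `η ∈ E*`
(for a dual basis vector `η = e_i^*` it is `x_i' = ∂H/∂ξ_i`). -/
structure HamiltonEquationsAt (φ : OpenPartialHomeomorph G H) (J : Set ℝ)
    (g : ℝ → G) (p : ∀ s : ℝ, CotangentSpace I (g s)) (u : GroupLieAlgebra I G) (t : ℝ) :
    Prop where
  position : ∀ η : E →L[ℝ] ℝ,
    HasDerivWithinAt (fun s => η (φ.extend I (g s)))
      (fderiv ℝ (fun ξ => coordHamiltonian I φ u (φ.extend I (g t)) ξ)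
        (momentumCoord I φ (g t) (p t)) η) J t
  momentum :
    HasDerivWithinAt (fun s => momentumCoord I φ (g s) (p s))
      (-fderiv ℝ (fun x => coordHamiltonian I φ u x (momentumCoord I φ (g t) (p t)))
        (φ.extend I (g t))) J t

/-- The curve `g`, defined on `J`, has at the time `t` the velocity `w ∈ T_{g t} G`. -/
def HasVelocityWithinAt (g : ℝ → G) (J : Set ℝ) (t : ℝ) (w : TangentSpace I (g t)) : Prop :=
  HasMFDerivWithinAt 𝓘(ℝ, ℝ) I g J t ((1 : ℝ →L[ℝ] ℝ).smulRight w)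

end LieHamiltonian

end

/-! In a chart, let `A x v` be the coordinate vector at `x` of the left-invariant field of `v`
(`coordFrame`). Then `H = ξ (A x u)` and `ψ = ξ ∘ A x`. As `H` is linear in `ξ`, the first canonical
equation reads `x' = A x u`, which is the velocity equation in coordinates. Along such a curve the
product rule turns `ξ' = -ξ ∘ D(A u)` into `ψ(v)' = ξ (D(A v)(A u) - D(A u)(A v))`, that is, `ξ` of
the bracket of the fields `A u` and `A v`; this is `ψ [u, v]` because brackets commute with passing
to coordinates (`coordFrame_bracket`). Conversely, `A x` is invertible, so `ξ = ψ ∘ (A x)⁻¹`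
inherits differentiability and the computation can be reversed (`hasDerivWithinAt_momentum_iff`). -/

namespace LieHamiltonian

open Filter VectorField IsManifold

/-! ### Calculus in a finite-dimensional vector space. -/

section Euclidean

variable {E : Type*} [NormedAddCommGroup E] [NormedSpace ℝ E] [FiniteDimensional ℝ E]

/-- In finite dimension, a curve is differentiable as soon as all its images under linear
functionals are. -/
theorem hasDerivWithinAt_iff_forall_dual {x : ℝ → E} {x' : E} {J : Set ℝ} {t : ℝ} :
    HasDerivWithinAt x x' J t ↔
      ∀ η : E →L[ℝ] ℝ, HasDerivWithinAt (fun s => η (x s)) (η x') J t := by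
  refine ⟨fun h η => η.hasFDerivAt.comp_hasDerivWithinAt t h, fun h => ?_⟩
  let e : E ≃L[ℝ] (Fin (Module.finrank ℝ E) → ℝ) := ContinuousLinearEquiv.ofFinrankEq (by simp)
  have he : HasDerivWithinAt (fun s => e (x s)) (e x') J t :=
    hasDerivWithinAt_pi.2 fun i =>
      h ((ContinuousLinearMap.proj (R := ℝ) (φ := fun _ => ℝ) i).comp e.toContinuousLinearMap)
  simpa [Function.comp_def] using e.symm.hasFDerivAt.comp_hasDerivWithinAt t he

/-- In finite dimension, a curve of linear maps is differentiable as soon as it is pointwise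
differentiable. -/
theorem hasDerivWithinAt_dual_iff_forall_apply {ψ : ℝ → E →L[ℝ] ℝ} {ψ' : E →L[ℝ] ℝ} {J : Set ℝ}
    {t : ℝ} : HasDerivWithinAt ψ ψ' J t ↔
      ∀ v : E, HasDerivWithinAt (fun s => ψ s v) (ψ' v) J t := by
  refine ⟨fun h v => (ContinuousLinearMap.apply ℝ ℝ v).hasFDerivAt.comp_hasDerivWithinAt t h,
    fun h => ?_⟩
  let b := Module.finBasis ℝ E
  have key : ∀ χ : E →L[ℝ] ℝ,
      χ = ∑ i, χ (b i) • LinearMap.toContinuousLinearMap (b.coord i) := by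
    intro χ
    ext v
    conv_lhs => rw [← b.sum_repr v]
    simp [mul_comm, -Module.Basis.sum_repr]
  rw [key ψ', funext fun s => key (ψ s)]
  refine HasDerivWithinAt.fun_sum fun i _ => ?_
  have := (h (b i)).smul_const (LinearMap.toContinuousLinearMap (b.coord i))
  exact this

/-- If a linear frame `A` of `E` and a point `x` moving along it are differentiable, then the
components `ξ ∘ A x` of a covector `ξ` are differentiable iff `ξ` is, and the adjoint equation for
`ξ` is equivalent to the one for the components, with the Lie brackets of the frame. -/
theorem hasDerivWithinAt_momentum_iff {A : E → E →L[ℝ] E} {x : ℝ → E} {ξ ψ : ℝ → E →L[ℝ] ℝ}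
    {J : Set ℝ} {t : ℝ} {u : E} (ht : t ∈ J) (hJ : UniqueDiffWithinAt ℝ J t)
    (hA : DifferentiableAt ℝ A (x t)) (hinv : ∀ᶠ s in 𝓝[J] t, (A (x s)).IsInvertible)
    (hψ : ∀ᶠ s in 𝓝[J] t, ψ s = (ξ s).comp (A (x s)))
    (hx : HasDerivWithinAt x (A (x t) u) J t) :
    HasDerivWithinAt ξ (-(ξ t).comp (fderiv ℝ (fun y => A y u) (x t))) J t ↔
      ∀ v, HasDerivWithinAt (fun s => ψ s v)
        (ξ t (lieBracket ℝ (fun y => A y u) (fun y => A y v) (x t))) J t := by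
  have hAv : ∀ v, fderiv ℝ (fun y => A y v) (x t) = (fderiv ℝ A (x t)).flip v := fun v => by
    ext w
    simp [fderiv_clm_apply hA (differentiableAt_const v)]
  have hAx : HasDerivWithinAt (fun s => A (x s)) (fderiv ℝ A (x t) (A (x t) u)) J t :=
    hA.hasFDerivAt.comp_hasDerivWithinAt t hx
  have hprod : ∀ {ξ'}, HasDerivWithinAt ξ ξ' J t → HasDerivWithinAt ψ
      (ξ'.comp (A (x t)) + (ξ t).comp (fderiv ℝ A (x t) (A (x t) u))) J t := fun h =>
    (h.clm_comp hAx).congr_of_eventuallyEq hψ (hψ.self_of_nhdsWithin ht)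
  constructor
  · intro h v
    convert hasDerivWithinAt_dual_iff_forall_apply.1 (hprod h) v using 1
    simp only [lieBracket, hAv]
    simp
    ring
  · intro h
    -- The derivatives prescribed for the components, assembled into one covector.
    let ψ' : E →L[ℝ] ℝ := (ξ t).comp (fderiv ℝ A (x t) (A (x t) u) -
      ((fderiv ℝ A (x t)).flip u).comp (A (x t)))
    have hψ' : HasDerivWithinAt ψ ψ' J t := by
      refine hasDerivWithinAt_dual_iff_forall_apply.2 fun v => ?_
      convert h v using 1
      simp [lieBracket, hAv, ψ']
    have hinvt := hinv.self_of_nhdsWithin ht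
    -- Inversion is smooth near an invertible map, so `(A x)⁻¹` is differentiable along the curve.
    have hBd : DifferentiableWithinAt ℝ (fun s => (A (x s)).inverse) J t := by
      obtain ⟨e, he⟩ := hinvt
      have := (contDiffAt_map_inverse (𝕜 := ℝ) (n := 1) e).differentiableAt one_ne_zero
      rw [he] at this
      exact this.comp_differentiableWithinAt t hAx.differentiableWithinAt
    have hξψ : ∀ s, (A (x s)).IsInvertible → ψ s = (ξ s).comp (A (x s)) →
        ξ s = (ψ s).comp (A (x s)).inverse := by
      intro s hs h's
      rw [h's]
      obtain ⟨e, he⟩ := hs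
      rw [← he, ContinuousLinearMap.inverse_equiv]
      ext w
      simp
    have hξd : DifferentiableWithinAt ℝ ξ J t := by
      refine (hψ'.differentiableWithinAt.clm_comp hBd).congr_of_eventuallyEq ?_
        (hξψ t hinvt (hψ.self_of_nhdsWithin ht))
      filter_upwards [hinv, hψ] with s hs h's using hξψ s hs h's
    -- The product rule gives a second derivative of `ψ`. Equating it with `ψ'` cancels the term `ξ
    -- ∘ DA(A u)`; the common right factor `A x` is then removed by testing on `e.symm w`.
    have heq := (hJ.eq_deriv _ (hprod hξd.hasDerivWithinAt) hψ')
    suffices h' : -(ξ t).comp (fderiv ℝ (fun y => A y u) (x t)) = derivWithin ξ J t by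
      rw [h']
      exact hξd.hasDerivWithinAt
    obtain ⟨e, he⟩ := hinvt
    ext w
    have := DFunLike.congr_fun heq (e.symm w)
    rw [hAv]
    simp [ψ', ← he] at this ⊢
    linarith

end Euclidean

/-! ### Charts and their differentials. -/

section Manifold

variable {E : Type*} [NormedAddCommGroup E] [NormedSpace ℝ E]
  {H : Type*} [TopologicalSpace H] {I : ModelWithCorners ℝ E H}
  {M : Type*} [TopologicalSpace M] [ChartedSpace H M]
  {φ : OpenPartialHomeomorph M H} {n : ℕ∞ω}

theorem contMDiffAt_extend_symm [I.Boundaryless] (hφ : φ ∈ maximalAtlas I n M) {y : E}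
    (hy : y ∈ (φ.extend I).target) : ContMDiffAt 𝓘(ℝ, E) I n (φ.extend I).symm y := by
  have h := contMDiffOn_extend_symm hφ
  rw [← φ.extend_target'] at h
  exact h.contMDiffAt (φ.isOpen_extend_target.mem_nhds hy)

omit [ChartedSpace H M] in
theorem extend_symm_mem_source {y : E} (hy : y ∈ (φ.extend I).target) :
    (φ.extend I).symm y ∈ φ.source := by
  simpa using (φ.extend I).map_target hy

/-- The differentials of a chart and of its inverse are inverse to each other. -/
theorem mfderiv_extend_comp_mfderiv_extend_symm [I.Boundaryless] (hφ : φ ∈ maximalAtlas I n M)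
    (hn : n ≠ 0) {y : E} (hy : y ∈ (φ.extend I).target) :
    (mfderiv I 𝓘(ℝ, E) (φ.extend I) ((φ.extend I).symm y)).comp
      (mfderiv 𝓘(ℝ, E) I (φ.extend I).symm y) = ContinuousLinearMap.id ℝ _ := by
  rw [← mfderiv_comp y
    ((φ.contMDiffAt_extend hφ (extend_symm_mem_source hy)).mdifferentiableAt hn)
    ((contMDiffAt_extend_symm hφ hy).mdifferentiableAt hn), ← mfderiv_id (I := 𝓘(ℝ, E))]
  apply Filter.EventuallyEq.mfderiv_eq
  filter_upwards [φ.isOpen_extend_target.mem_nhds hy] with z hz using (φ.extend I).right_inv hz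

theorem mfderiv_extend_symm_comp_mfderiv_extend [I.Boundaryless] (hφ : φ ∈ maximalAtlas I n M)
    (hn : n ≠ 0) {y : E} (hy : y ∈ (φ.extend I).target) :
    (mfderiv 𝓘(ℝ, E) I (φ.extend I).symm y).comp
      (mfderiv I 𝓘(ℝ, E) (φ.extend I) ((φ.extend I).symm y)) = ContinuousLinearMap.id ℝ _ := by
  have hs := extend_symm_mem_source hy
  have h1 : MDifferentiableAt 𝓘(ℝ, E) I (φ.extend I).symm (φ.extend I ((φ.extend I).symm y)) := by
    rw [(φ.extend I).right_inv hy]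
    exact (contMDiffAt_extend_symm hφ hy).mdifferentiableAt hn
  have h2 := mfderiv_comp _ h1 ((φ.contMDiffAt_extend hφ hs).mdifferentiableAt hn)
  have h3 : mfderiv I I ((φ.extend I).symm ∘ φ.extend I) ((φ.extend I).symm y) =
      mfderiv I I id ((φ.extend I).symm y) := by
    apply Filter.EventuallyEq.mfderiv_eq
    filter_upwards [φ.open_source.mem_nhds hs] with z hz using φ.extend_left_inv hz
  rw [h3, mfderiv_id, (φ.extend I).right_inv hy] at h2
  exact h2.symm

theorem isInvertible_mfderiv_extend_symm [I.Boundaryless] (hφ : φ ∈ maximalAtlas I n M)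
    (hn : n ≠ 0) {y : E} (hy : y ∈ (φ.extend I).target) :
    (mfderiv 𝓘(ℝ, E) I (φ.extend I).symm y).IsInvertible :=
  .of_inverse (mfderiv_extend_symm_comp_mfderiv_extend hφ hn hy)
    (mfderiv_extend_comp_mfderiv_extend_symm hφ hn hy)

theorem inverse_mfderiv_extend_symm [I.Boundaryless] (hφ : φ ∈ maximalAtlas I n M)
    (hn : n ≠ 0) {y : E} (hy : y ∈ (φ.extend I).target) :
    (mfderiv 𝓘(ℝ, E) I (φ.extend I).symm y).inverse =
      mfderiv I 𝓘(ℝ, E) (φ.extend I) ((φ.extend I).symm y) :=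
  ContinuousLinearMap.inverse_eq (mfderiv_extend_symm_comp_mfderiv_extend hφ hn hy)
    (mfderiv_extend_comp_mfderiv_extend_symm hφ hn hy)

/-- The velocity of a curve can be read off in any chart of the maximal atlas. -/
theorem hasVelocityWithinAt_iff_hasDerivWithinAt [I.Boundaryless] (hφ : φ ∈ maximalAtlas I n M)
    (hn : n ≠ 0) {g : ℝ → M} {J : Set ℝ} {t : ℝ} (hg : ContinuousWithinAt g J t)
    (hgt : g t ∈ φ.source) (w : TangentSpace I (g t)) :
    HasVelocityWithinAt I g J t w ↔ HasDerivWithinAt (fun s => φ.extend I (g s))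
      (show E from mfderiv I 𝓘(ℝ, E) (φ.extend I) (g t) w) J t := by
  have hy : φ.extend I (g t) ∈ (φ.extend I).target := (φ.extend I).map_source (by simpa using hgt)
  have hl := φ.extend_left_inv (I := I) hgt
  have hmd := ((φ.contMDiffAt_extend hφ hgt).mdifferentiableAt hn).hasMFDerivAt
  rw [hasDerivWithinAt_iff_hasFDerivWithinAt]
  constructor
  · intro h
    have h1 := (hmd.comp_hasMFDerivWithinAt t h).hasFDerivWithinAt
    refine h1.congr_fderiv ?_
    ext
    exact map_smul (mfderiv I 𝓘(ℝ, E) (φ.extend I) (g t)) (1 : ℝ) w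
  · intro h
    have hmd' := ((contMDiffAt_extend_symm hφ hy).mdifferentiableAt hn).hasMFDerivAt
    have h1 := hmd'.comp_hasMFDerivWithinAt t h.hasMFDerivWithinAt
    -- Continuity keeps `g` in the chart domain near `t`, where its coordinates determine it.
    have hev : g =ᶠ[𝓝[J] t] (φ.extend I).symm ∘ fun s => φ.extend I (g s) := by
      filter_upwards [hg (φ.open_source.mem_nhds hgt)] with s hs
        using (φ.extend_left_inv (I := I) hs).symm
    have h2 := h1.congr_of_eventuallyEq hev hl.symm
    refine h2.congr_mfderiv ?_
    ext
    have h3 := DFunLike.congr_fun (mfderiv_extend_symm_comp_mfderiv_extend hφ hn hy) w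
    rw [hl] at h3
    exact (congrArg _ (one_smul ℝ _)).trans (h3.trans (one_smul ℝ _).symm)

end Manifold

/-! ### The left-invariant frame in a chart. -/

section LieGroup

variable {E : Type*} [NormedAddCommGroup E] [NormedSpace ℝ E]
  {H : Type*} [TopologicalSpace H] {I : ModelWithCorners ℝ E H}
  {G : Type*} [TopologicalSpace G] [ChartedSpace H G] [Group G]

variable (I) in
/-- The left-invariant vector fields read in the chart `φ`: `coordFrame I φ y v` is the coordinate
vector at `y` of the left-invariant field extending `v`. -/
noncomputable def coordFrame (φ : OpenPartialHomeomorph G H) (y : E) : E →L[ℝ] E :=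
  (show E →L[ℝ] E from mfderiv I 𝓘(ℝ, E) (φ.extend I) ((φ.extend I).symm y)).comp
    (show E →L[ℝ] E from dl I ((φ.extend I).symm y))

theorem fderiv_coordHamiltonian_momentum (φ : OpenPartialHomeomorph G H) (u : GroupLieAlgebra I G)
    (y : E) (ξ η : E →L[ℝ] ℝ) :
    fderiv ℝ (fun ζ => coordHamiltonian I φ u y ζ) ξ η = η (coordFrame I φ y u) := by
  have h : (fun ζ => coordHamiltonian I φ u y ζ) =
      ContinuousLinearMap.apply ℝ ℝ (coordFrame I φ y u) := rfl
  rw [h, ContinuousLinearMap.fderiv]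
  rfl

theorem fderiv_coordHamiltonian_position {φ : OpenPartialHomeomorph G H} {y : E}
    (h : DifferentiableAt ℝ (coordFrame I φ) y) (u : E) (ξ : E →L[ℝ] ℝ) :
    fderiv ℝ (fun z => coordHamiltonian I φ u z ξ) y =
      ξ.comp (fderiv ℝ (fun z => coordFrame I φ z u) y) := by
  have hu : DifferentiableAt ℝ (fun z => coordFrame I φ z u) y :=
    h.clm_apply (differentiableAt_const u)
  exact (ξ.hasFDerivAt.comp y hu.hasFDerivAt).fderiv

theorem lieGroup_minSmoothness [LieGroup I ∞ G] : LieGroup I (minSmoothness ℝ 3) G :=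
  LieGroup.of_le (n := ∞) (by simpa using WithTop.coe_le_coe.2 (le_top (a := (3 : ℕ∞))))

/-- The inverse is the differential of the left shift by `a⁻¹`, by the chain rule. -/
theorem isInvertible_dl [LieGroup I ∞ G] (a : G) : (show E →L[ℝ] E from dl I a).IsInvertible := by
  have hmd : ∀ b c : G, MDifferentiableAt I I (fun x : G => b * x) c := fun b c =>
    (contMDiff_mul_left (I := I) (n := ∞)).mdifferentiableAt (by simp)
  have h1 := mfderiv_comp (1 : G) (hmd a⁻¹ (a * 1)) (hmd a 1)
  have h2 := mfderiv_comp (a * 1 : G) (by simpa using hmd a (a⁻¹ * (a * 1))) (hmd a⁻¹ (a * 1))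
  have e1 : (fun x : G => a⁻¹ * x) ∘ (fun x => a * x) = id := by ext x; simp
  have e2 : (fun x : G => a * x) ∘ (fun x => a⁻¹ * x) = id := by ext x; simp
  rw [e1, mfderiv_id] at h1
  rw [e2, mfderiv_id, inv_mul_cancel_left] at h2
  exact .of_inverse (g := mfderiv I I (fun x : G => a⁻¹ * x) (a * 1)) h2.symm h1.symm

variable [I.Boundaryless] {φ : OpenPartialHomeomorph G H} {n : ℕ∞ω}

/-- Gives access to the smoothness and bracket results for `mulInvariantVectorField`. -/
theorem coordFrame_eq_mpullback (hφ : φ ∈ maximalAtlas I n G) (hn : n ≠ 0)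
    {y : E} (hy : y ∈ (φ.extend I).target) (v : GroupLieAlgebra I G) :
    coordFrame I φ y v =
      mpullback 𝓘(ℝ, E) I (φ.extend I).symm (mulInvariantVectorField v) y := by
  rw [mpullback_apply, inverse_mfderiv_extend_symm hφ hn hy]
  rfl

/-- Insert `d(φ⁻¹) ∘ dφ = id` between `p` and `dl`. -/
theorem leftTrivialize_eq_comp_coordFrame (hφ : φ ∈ maximalAtlas I n G) (hn : n ≠ 0) {a : G}
    (ha : a ∈ φ.source) (p : CotangentSpace I a) :
    (show E →L[ℝ] ℝ from leftTrivialize I a p) =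
      (momentumCoord I φ a p).comp (coordFrame I φ (φ.extend I a)) := by
  have hy : φ.extend I a ∈ (φ.extend I).target := (φ.extend I).map_source (by simpa using ha)
  ext v
  have h := DFunLike.congr_fun (mfderiv_extend_symm_comp_mfderiv_extend hφ hn hy)
    (dl I ((φ.extend I).symm (φ.extend I a)) v)
  refine Eq.trans ?_ (congrArg (show E →L[ℝ] ℝ from p) h).symm
  rw [φ.extend_left_inv (I := I) ha]
  rfl

variable [LieGroup I ∞ G]

theorem isInvertible_coordFrame (hφ : φ ∈ maximalAtlas I n G) (hn : n ≠ 0)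
    {y : E} (hy : y ∈ (φ.extend I).target) : (coordFrame I φ y).IsInvertible :=
  ContinuousLinearMap.IsInvertible.comp
    (.of_inverse (mfderiv_extend_comp_mfderiv_extend_symm hφ hn hy)
      (mfderiv_extend_symm_comp_mfderiv_extend hφ hn hy)) (isInvertible_dl _)

variable [FiniteDimensional ℝ E]

theorem contDiffOn_coordFrame (hφ : φ ∈ maximalAtlas I ∞ G) :
    ContDiffOn ℝ 1 (coordFrame I φ) (φ.extend I).target := by
  have := lieGroup_minSmoothness (I := I) (G := G)
  -- In finite dimension it suffices to treat each field `A v` separately.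
  refine contDiffOn_clm_apply.2 fun v y hy => ContDiffAt.contDiffWithinAt ?_
  have h := ContMDiffAt.mpullback_vectorField_preimage (n := ∞) (m := 1)
    (V := mulInvariantVectorField (I := I) (G := G) v)
    (((contMDiffAt_mulInvariantVectorField v).of_le (by simp)))
    (contMDiffAt_extend_symm hφ hy)
    (isInvertible_mfderiv_extend_symm hφ (by simp) hy) (by norm_cast)
  refine (contMDiffAt_vectorSpace_iff_contDiffAt.1 h).congr_of_eventuallyEq ?_
  filter_upwards [φ.isOpen_extend_target.mem_nhds hy] with z hz
    using coordFrame_eq_mpullback hφ (by simp) hz v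

theorem differentiableAt_coordFrame (hφ : φ ∈ maximalAtlas I ∞ G) {y : E}
    (hy : y ∈ (φ.extend I).target) : DifferentiableAt ℝ (coordFrame I φ) y :=
  ((contDiffOn_coordFrame hφ).contDiffAt (φ.isOpen_extend_target.mem_nhds hy)).differentiableAt
    one_ne_zero

/-- In a chart, the bracket of the Lie algebra is the bracket of coordinate vector fields. -/
theorem coordFrame_bracket (hφ : φ ∈ maximalAtlas I ∞ G) {y : E}
    (hy : y ∈ (φ.extend I).target) (v w : GroupLieAlgebra I G) :
    coordFrame I φ y (show GroupLieAlgebra I G from ⁅v, w⁆) =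
      lieBracket ℝ (fun z => coordFrame I φ z v) (fun z => coordFrame I φ z w) y := by
  have := lieGroup_minSmoothness (I := I) (G := G)
  have : CompleteSpace E := FiniteDimensional.complete ℝ E
  have hev : ∀ v : GroupLieAlgebra I G, (fun z => coordFrame I φ z v) =ᶠ[𝓝 y]
      mpullback 𝓘(ℝ, E) I (φ.extend I).symm (mulInvariantVectorField v) := by
    intro v
    filter_upwards [φ.isOpen_extend_target.mem_nhds hy] with z hz
      using coordFrame_eq_mpullback hφ (by simp) hz v
  rw [coordFrame_eq_mpullback hφ (by simp) hy, GroupLieAlgebra.bracket_def,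
    mulInvariantVector_mlieBracket, mpullback_mlieBracket (n := ∞)
      (mdifferentiableAt_mulInvariantVectorField v) (mdifferentiableAt_mulInvariantVectorField w)
      (contMDiffAt_extend_symm hφ hy)
      (by simpa using WithTop.coe_le_coe.2 (le_top (a := (2 : ℕ∞)))),
    ← mlieBracketWithin_univ, mlieBracketWithin_eq_lieBracketWithin]
  exact (congrFun lieBracketWithin_univ y).trans ((hev v).lieBracket_vectorField_eq (hev w)).symm

end LieGroup

end LieHamiltonian

/-! ### Assembly of the equivalence. -/

open LieHamiltonian in
theorem theorem2p3
    {E : Type*} [NormedAddCommGroup E] [NormedSpace ℝ E] [FiniteDimensional ℝ E]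
    {H : Type*} [TopologicalSpace H] (I : ModelWithCorners ℝ E H) [I.Boundaryless]
    {G : Type*} [TopologicalSpace G] [ChartedSpace H G] [Group G] [LieGroup I ∞ G]
    -- an interval of times, a control, and a curve of covectors `p s ∈ T*_{g s} G`
    (J : Set ℝ) (hJ : J.OrdConnected) (hJ' : J.Nontrivial)
    (u : ℝ → GroupLieAlgebra I G)
    (g : ℝ → G) (hg : ContinuousOn g J)
    (p : ∀ s : ℝ, LieHamiltonian.CotangentSpace I (g s))
    -- an arbitrary time and an arbitrary chart of the smooth structure around `g t`
    (t : ℝ) (ht : t ∈ J)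
    (φ : OpenPartialHomeomorph G H) (hφ : φ ∈ IsManifold.maximalAtlas I ∞ G)
    (hgt : g t ∈ φ.source) :
    LieHamiltonian.HamiltonEquationsAt I φ J g p (u t) t ↔
      LieHamiltonian.HasVelocityWithinAt I g J t (LieHamiltonian.dl I (g t) (u t)) ∧
      ∀ v : GroupLieAlgebra I G,
        HasDerivWithinAt (fun s => LieHamiltonian.leftTrivialize I (g s) (p s) v)
          (LieHamiltonian.leftTrivialize I (g t) (p t) ⁅u t, v⁆) J t := by
  have hn : (∞ : ℕ∞ω) ≠ 0 := by simp
  have hsrc : ∀ {a : G}, a ∈ φ.source → φ.extend I a ∈ (φ.extend I).target := fun ha =>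
    (φ.extend I).map_source (by simpa using ha)
  have hy := hsrc hgt
  have hA := differentiableAt_coordFrame hφ hy
  have hev : ∀ᶠ s in 𝓝[J] t, g s ∈ φ.source := hg t ht (φ.open_source.mem_nhds hgt)
  have hpos : (∀ η : E →L[ℝ] ℝ, HasDerivWithinAt (fun s => η (φ.extend I (g s)))
        (fderiv ℝ (fun ξ => coordHamiltonian I φ (u t) (φ.extend I (g t)) ξ)
          (momentumCoord I φ (g t) (p t)) η) J t) ↔
      HasDerivWithinAt (fun s => φ.extend I (g s))
        (coordFrame I φ (φ.extend I (g t)) (u t)) J t := by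
    simp only [fderiv_coordHamiltonian_momentum]
    exact hasDerivWithinAt_iff_forall_dual.symm
  have hvel : HasVelocityWithinAt I g J t (dl I (g t) (u t)) ↔
      HasDerivWithinAt (fun s => φ.extend I (g s))
        (coordFrame I φ (φ.extend I (g t)) (u t)) J t := by
    refine (hasVelocityWithinAt_iff_hasDerivWithinAt hφ hn (hg t ht) hgt _).trans ?_
    have h := φ.extend_left_inv (I := I) hgt
    have h' : (coordFrame I φ (φ.extend I (g t)) (u t)) =
        (show E from mfderiv I 𝓘(ℝ, E) (φ.extend I) (g t) (dl I (g t) (u t))) := by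
      change (show E →L[ℝ] E from mfderiv I 𝓘(ℝ, E) (φ.extend I)
        ((φ.extend I).symm (φ.extend I (g t))))
        ((show E →L[ℝ] E from dl I ((φ.extend I).symm (φ.extend I (g t)))) (u t)) = _
      rw [h]
      rfl
    rw [h']
  have hbr : ∀ v : GroupLieAlgebra I G, leftTrivialize I (g t) (p t) ⁅u t, v⁆ =
      momentumCoord I φ (g t) (p t) (VectorField.lieBracket ℝ
        (fun z => coordFrame I φ z (u t)) (fun z => coordFrame I φ z v) (φ.extend I (g t))) := by
    intro v
    rw [← coordFrame_bracket hφ hy]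
    exact DFunLike.congr_fun (leftTrivialize_eq_comp_coordFrame hφ hn hgt (p t)) _
  -- The position equation `hx` stays an argument: the momentum equations are equivalent only along
  -- curves satisfying it. Being nontrivial, the interval has nonempty interior, so derivatives in
  -- `J` are unique, end points included.
  have hmom := fun hx => hasDerivWithinAt_momentum_iff (A := coordFrame I φ)
    (x := fun s => φ.extend I (g s)) (ξ := fun s => momentumCoord I φ (g s) (p s))
    (ψ := fun s => leftTrivialize I (g s) (p s)) (u := u t) ht
    (uniqueDiffWithinAt_convex hJ.convex (hJ.convex.nontrivial_iff_nonempty_interior.1 hJ')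
      (subset_closure ht)) hA
    (hev.mono fun s hs => isInvertible_coordFrame hφ hn (hsrc hs))
    (hev.mono fun s hs => leftTrivialize_eq_comp_coordFrame hφ hn hs (p s)) hx
  have hfd := fderiv_coordHamiltonian_position hA (u t) (momentumCoord I φ (g t) (p t))
  rw [hvel]
  constructor
  · rintro ⟨h1, h2⟩
    have hx := hpos.1 h1
    refine ⟨hx, fun v => ?_⟩
    rw [hfd] at h2
    rw [hbr]
    exact (hmom hx).1 h2 v
  · rintro ⟨hx, h⟩
    refine ⟨hpos.2 hx, ?_⟩
    rw [hfd]
    refine (hmom hx).2 fun v => ?_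
    exact (hbr v) ▸ h v
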